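/- Let $n,m\ge 1$, $A\in\mathbb R^{n\times n}$, $B\in\mathbb R^{n\times m}$ with $(A,B)$ stabilizable (some $A-BK$ has spectral radius $<1$), and let $S\in\mathbb R^{n\times n}$, $R\in\mathbb R^{m\times m}$ be symmetric positive definite. For a symmetric cost matrix $S'$ and $P\succeq 0$ let $$\mathcal R(P,S')=A^\top PA+S'-A^\top PB\,(R+B^\top PB)^{-1}B^\top PA ,$$ which is $\mathcal H(\mathcal Q(P))$, the Schur complement of the $uu$ block in the matrix $$\mathcal Q(P)=\begin{pmatrix}A^\top PA+S' & A^\top PB\\ B^\top PA & B^\top PB+R\end{pmatrix}.$$ Exact value iteration (VI) with cost $S'$ is $P_{i+1}=\mathcal R(P_i,S')$; inexact VI is $\hat P_{i+1}=\mathcal R(\hat P_i,S)+\Delta_i$, where $(\Delta_i)_{i\ge0}$ is a bounded sequence of symmetric $n\times n$ matrices. Write $\|\cdot\|_2$ for the spectral norm, $\|\Delta\|_\infty=\sup_i\|\Delta_i\|_2$, and $\lambda_{\min}(S)$ for the smallest eigenvalue of $S$. A function $\gamma:\mathbb R_+\to\mathbb R_+$ is of class $\mathcal K$ if it is continuous,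 strictly increasing and $\gamma(0)=0$; a function $\beta:\mathbb R_+\times\mathbb Z_+\to\mathbb R_+$ is of class $\mathcal{KL}$ if $\beta(\cdot,i)$ is of class $\mathcal K$ for every $i$ and $\beta(r,\cdot)$ decreases to $0$ (not necessarily strictly) for every $r\ge0$. Theorem 4.2 (Small-Disturbance ISS of Inexact VI). 1. For every $\delta>-\lambda_{\min}(S)$ the equation $P=\mathcal R(P,S+\delta I)$ has a unique positive semidefinite solution $P^*(\delta)$; it is positive definite, and $\delta\mapsto P^*(\delta)$ is $C^\infty$ on $(-\lambda_{\min}(S),\infty)$. Put $P^*=P^*(0)$. 2. Inexact VI is small-disturbance input-to-state stable at its equilibrium $P^*$, with threshold $\lambda_{\min}(S)>0$: there are a class-$\mathcal{KL}$ function $\beta$ and a class-$\mathcal K$ function $\gamma$ (depending only on $A,B,S,R$) such that, for all $\Delta$ with $\|\Delta\|_\infty<\lambda_{\min}(S)$, all $\hat P_0\succeq0$ and all $i\in\mathbb Z_+$, $$\|\hat P_i-P^*\|_2\le\beta(\|\hat P_0-P^*\|_2,i)+\gamma(\|\Delta\|_\infty).$$ 3. For all such $\Delta$, $\hat P_0$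 and $i$, one has $\hat P_i\succeq0$ and $P_i^-\preceq\hat P_i\preceq P_i^+$, where $(P_i^\pm)$ are the exact VI sequences with costs $S\pm\|\Delta\|_\infty I$ and $P_0^\pm=\hat P_0$. -/

import Mathlib

open scoped NNReal Matrix ContDiff Matrix.Norms.L2Operator

noncomputable section

/-- Class `K`: continuous, strictly increasing functions on the nonnegative reals that vanish
at the origin. -/
def IsClassK (γ : ℝ≥0 → ℝ≥0) : Prop :=
  Continuous γ ∧ StrictMono γ ∧ γ 0 = 0

/-- Class `KL` in discrete time: `β (·, i)` is of class `K` for every `i`, and `β (r, ·)`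
decreases to `0` for every `r`. -/
def IsClassKL (β : ℝ≥0 → ℕ → ℝ≥0) : Prop :=
  (∀ i, IsClassK fun r => β r i) ∧
    ∀ r, Antitone (β r) ∧ Filter.Tendsto (β r) Filter.atTop (nhds 0)

/-- The `ℓ^∞` norm of a sequence; it is only used together with `IsBoundedSeq`. -/
def linfNorm {E : Type*} [NormedAddCommGroup E] (Δ : ℕ → E) : ℝ≥0 :=
  ⨆ i, ‖Δ i‖₊

/-- The sequence is bounded in norm, so that its `ℓ^∞` norm is finite. -/
def IsBoundedSeq {E : Type*} [NormedAddCommGroup E] (Δ : ℕ → E) : Prop :=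
  BddAbove (Set.range fun i => ‖Δ i‖₊)

/-- The trajectory of the system `x (i + 1) = f (x i) (Δ i)` started at `x₀`. -/
def trajectory {E D : Type*} (f : E → D → E) (Δ : ℕ → D) (x₀ : E) : ℕ → E
  | 0 => x₀
  | i + 1 => f (trajectory f Δ x₀ i) (Δ i)

/-- Small-disturbance input-to-state stability, at the equilibrium `xs` and with disturbance
threshold `d`, of the system `x (i + 1) = f (x i) (Δ i)` with initial states in `X` and
disturbances in `U`. The comparison functions depend neither on the disturbance
nor on the initial state. -/
def SmallDisturbanceISS {E D : Type*} [NormedAddCommGroup E] [NormedAddCommGroup D]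
    (f : E → D → E) (X : Set E) (U : Set D) (xs : E) (d : ℝ) : Prop :=
  0 < d ∧ f xs 0 = xs ∧
    ∃ (β : ℝ≥0 → ℕ → ℝ≥0) (γ : ℝ≥0 → ℝ≥0), IsClassKL β ∧ IsClassK γ ∧
      ∀ Δ : ℕ → D, (∀ i, Δ i ∈ U) → IsBoundedSeq Δ → (linfNorm Δ : ℝ) < d →
        ∀ x₀ ∈ X, ∀ i : ℕ,
          ‖trajectory f Δ x₀ i - xs‖₊ ≤ β ‖x₀ - xs‖₊ i + γ (linfNorm Δ)

/-- A real square matrix is Schur stable if its spectral radius (over the complex numbers) is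
less than one. -/
def IsSchurStable {n : ℕ} (M : Matrix (Fin n) (Fin n) ℝ) : Prop :=
  spectralRadius ℂ (M.map (algebraMap ℝ ℂ)) < 1

/-- `(A, B)` is stabilizable: some linear state feedback makes the closed loop Schur stable. -/
def IsStabilizable {n m : ℕ} (A : Matrix (Fin n) (Fin n) ℝ) (B : Matrix (Fin n) (Fin m) ℝ) :
    Prop :=
  ∃ K : Matrix (Fin m) (Fin n) ℝ, IsSchurStable (A - B * K)

/-- The smallest eigenvalue of a real symmetric matrix (of positive dimension). -/
def lambdaMin {n : ℕ} (Y : Matrix (Fin n) (Fin n) ℝ) : ℝ :=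
  sInf (spectrum ℝ Y)

/-- The Hamiltonian operator `Q`; rows and columns are indexed by states, then inputs. -/
def hamiltonian {n m : ℕ} (A : Matrix (Fin n) (Fin n) ℝ) (B : Matrix (Fin n) (Fin m) ℝ)
    (S : Matrix (Fin n) (Fin n) ℝ) (R : Matrix (Fin m) (Fin m) ℝ)
    (P : Matrix (Fin n) (Fin n) ℝ) : Matrix (Fin n ⊕ Fin m) (Fin n ⊕ Fin m) ℝ :=
  Matrix.fromBlocks (Aᵀ * P * A + S) (Aᵀ * P * B) (Bᵀ * P * A) (Bᵀ * P * B + R)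

/-- The Schur complement operator `H` with respect to the input block. -/
def schurComplement {n m : ℕ} (Q : Matrix (Fin n ⊕ Fin m) (Fin n ⊕ Fin m) ℝ) :
    Matrix (Fin n) (Fin n) ℝ :=
  Q.toBlocks₁₁ - Q.toBlocks₂₁ᵀ * Q.toBlocks₂₂⁻¹ * Q.toBlocks₂₁

/-- One step of inexact value iteration, `H (Q P) + Δ`. -/
def inexactVIStep {n m : ℕ} (A : Matrix (Fin n) (Fin n) ℝ) (B : Matrix (Fin n) (Fin m) ℝ)
    (S : Matrix (Fin n) (Fin n) ℝ) (R : Matrix (Fin m) (Fin m) ℝ)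
    (P D : Matrix (Fin n) (Fin n) ℝ) : Matrix (Fin n) (Fin n) ℝ :=
  schurComplement (hamiltonian A B S R P) + D

/-- The iterates of inexact value iteration with disturbances `Δ`, started at `P₀`. -/
def inexactVI {n m : ℕ} (A : Matrix (Fin n) (Fin n) ℝ) (B : Matrix (Fin n) (Fin m) ℝ)
    (S : Matrix (Fin n) (Fin n) ℝ) (R : Matrix (Fin m) (Fin m) ℝ)
    (Δ : ℕ → Matrix (Fin n) (Fin n) ℝ) (P₀ : Matrix (Fin n) (Fin n) ℝ) :
    ℕ → Matrix (Fin n) (Fin n) ℝ :=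
  trajectory (inexactVIStep A B S R) Δ P₀

/-- The iterates of exact value iteration, `P (i + 1) = H (Q (P i))`, started at `P₀`. -/
def exactVI {n m : ℕ} (A : Matrix (Fin n) (Fin n) ℝ) (B : Matrix (Fin n) (Fin m) ℝ)
    (S : Matrix (Fin n) (Fin n) ℝ) (R : Matrix (Fin m) (Fin m) ℝ)
    (P₀ : Matrix (Fin n) (Fin n) ℝ) : ℕ → Matrix (Fin n) (Fin n) ℝ
  | 0 => P₀
  | i + 1 => schurComplement (hamiltonian A B S R (exactVI A B S R P₀ i))

/-- `P` solves the discrete algebraic Riccati equation `P = H (Q P)`. -/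
def SolvesDARE {n m : ℕ} (A : Matrix (Fin n) (Fin n) ℝ) (B : Matrix (Fin n) (Fin m) ℝ)
    (S : Matrix (Fin n) (Fin n) ℝ) (R : Matrix (Fin m) (Fin m) ℝ)
    (P : Matrix (Fin n) (Fin n) ℝ) : Prop :=
  P = schurComplement (hamiltonian A B S R P)

end

/-! With the state cost removed, the Riccati map is the minimum over gains `K` of `gainCost A B R K
P`, which is affine and monotone in `P`. Hence it is monotone on the positive semidefinite cone, and
scaling `P` by `t ≥ 1` scales its value by at most `t`.

Let `Q` be a fixed point for the cost `S`, and choose `c` with `c • Q ≤ S`. The state cost does not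
scale with `P`, so `P ≤ (1 + e) • Q` improves in one step to the factor `1 + (1 - c) * e`, and
similarly from below (`riccati_add_le_of_le`, `le_riccati_add_of_le`). Since `Q ≥ S ≥ l • 1`, a
disturbance of norm `ε ≤ l` moves the iterate by at most `(ε / l) • Q`. Relative errors thus obey `a
↦ (1 - c) * a + ε / l`, which yields a geometric `β` and a linear `γ`.

A change of cost is a constant disturbance, so the same estimate gives uniqueness and continuity of
the fixed point. For existence, iteration from zero increases, is bounded by the cost of a
stabilizing gain, and is Cauchy by the same contraction. For smoothness, the Riccati map has
derivative `H ↦ Fᵀ * H * F` at `Q`, with `F` the closed loop. As `Q` is a strict Lyapunov matrix for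
`F`, the identity minus this derivative is invertible, and the inverse function theorem applies. -/

noncomputable section

open scoped MatrixOrder
open Matrix

namespace Matrix

/-! ### Loewner order and the spectral norm -/

section LoewnerOrder

variable {ι κ : Type*}

lemma isSymm_of_nonneg {P : Matrix ι ι ℝ} (hP : 0 ≤ P) : Pᵀ = P := by
  simpa [conjTranspose_eq_transpose_of_trivial] using
    (nonneg_iff_posSemidef.1 hP).isHermitian.eq

variable [Fintype ι]

lemma smul_mono_left {P : Matrix ι ι ℝ} (hP : 0 ≤ P) {a b : ℝ} (h : a ≤ b) : a • P ≤ b • P :=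
  smul_le_smul_of_nonneg_right h hP

lemma smul_mono_right {P Q : Matrix ι ι ℝ} {a : ℝ} (ha : 0 ≤ a) (h : P ≤ Q) : a • P ≤ a • Q :=
  smul_le_smul_of_nonneg_left h ha

variable [Fintype κ]

lemma transpose_mul_mul_nonneg {P : Matrix ι ι ℝ} (hP : 0 ≤ P) (C : Matrix ι κ ℝ) :
    0 ≤ Cᵀ * P * C := by
  rw [nonneg_iff_posSemidef] at *
  simpa [conjTranspose_eq_transpose_of_trivial] using hP.conjTranspose_mul_mul_same C

lemma transpose_mul_mul_mono {P Q : Matrix ι ι ℝ} (h : P ≤ Q) (C : Matrix ι κ ℝ) :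
    Cᵀ * P * C ≤ Cᵀ * Q * C := by
  have := transpose_mul_mul_nonneg (sub_nonneg.2 h) C
  rwa [Matrix.mul_sub, Matrix.sub_mul, sub_nonneg] at this

variable [DecidableEq ι]

/-- Cauchy–Schwarz for the quadratic form of `M`. -/
lemma le_norm_smul_one {M : Matrix ι ι ℝ} (hM : M.IsSymm) : M ≤ ‖M‖ • (1 : Matrix ι ι ℝ) := by
  rw [le_iff]
  refine .of_dotProduct_mulVec_nonneg ?_ fun x => ?_
  · have : M.IsHermitian := by simpa [IsHermitian, conjTranspose_eq_transpose_of_trivial] using hM.eq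
    exact (isHermitian_one.smul (by simp [IsSelfAdjoint])).sub this
  · have h1 := real_inner_le_norm (WithLp.toLp 2 x)
      (toEuclideanCLM (n := ι) (𝕜 := ℝ) M (WithLp.toLp 2 x))
    have h2 := (toEuclideanCLM (n := ι) (𝕜 := ℝ) M).le_opNorm (WithLp.toLp 2 x)
    rw [l2_opNorm_toEuclideanCLM] at h2
    have h3 := real_inner_self_eq_norm_sq (WithLp.toLp 2 x)
    rw [inner_toEuclideanCLM] at h1
    simp only [EuclideanSpace.inner_eq_star_dotProduct, star_trivial] at h3
    simp only [star_trivial, sub_mulVec, smul_mulVec, one_mulVec, dotProduct_sub, dotProduct_smul,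
      smul_eq_mul]
    rw [h3]
    have := mul_le_mul_of_nonneg_left h2 (norm_nonneg (WithLp.toLp 2 x))
    simp only [] at h1
    nlinarith

lemma norm_le_of_le_smul_one {M : Matrix ι ι ℝ} {a : ℝ} (ha : 0 < a)
    (h₁ : -(a • (1 : Matrix ι ι ℝ)) ≤ M) (h₂ : M ≤ a • (1 : Matrix ι ι ℝ)) : ‖M‖ ≤ a := by
  have hd := sub_nonneg.2 h₂
  have hs : 0 ≤ a • (1 : Matrix ι ι ℝ) + M := by simpa [add_comm] using sub_nonneg.2 h₁
  have hMs : Mᵀ = M := by simpa using isSymm_of_nonneg hd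
  -- With `U = a • 1 + M` and `V = a • 1 - M`, which commute, `V * U * V + U * V * U = (U + V) * (U
  -- * V)`, and `U + V = (2 * a) • 1`.
  have e : 0 ≤ (2 * a) • (a ^ 2 • (1 : Matrix ι ι ℝ) - Mᵀ * M) := by
    have := add_nonneg (transpose_mul_mul_nonneg hs (a • 1 - M))
      (transpose_mul_mul_nonneg hd (a • 1 + M))
    refine this.trans_eq ?_
    simp only [transpose_sub, transpose_add, transpose_smul, transpose_one, hMs]
    simp only [smul_mul_assoc, mul_smul_comm, mul_add, add_mul, mul_sub, sub_mul, one_mul, mul_one,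
      smul_add, smul_sub, smul_smul, pow_two]
    module
  have e' : 0 ≤ a ^ 2 • (1 : Matrix ι ι ℝ) - Mᵀ * M := by
    have := smul_mono_right (inv_nonneg.2 (by positivity : 0 ≤ 2 * a)) e
    rwa [smul_zero, smul_smul, inv_mul_cancel₀ (by positivity), one_smul] at this
  rw [← l2_opNorm_toEuclideanCLM]
  refine ContinuousLinearMap.opNorm_le_bound _ ha.le fun x => ?_
  rw [← sq_le_sq₀ (norm_nonneg _) (by positivity)]
  rw [mul_pow, ← real_inner_self_eq_norm_sq, ← real_inner_self_eq_norm_sq]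
  have := (nonneg_iff_posSemidef.1 e').dotProduct_mulVec_nonneg x.ofLp
  simp only [EuclideanSpace.inner_eq_star_dotProduct, star_trivial, ofLp_toEuclideanCLM]
  have hM : x.ofLp ⬝ᵥ (Mᵀ * M) *ᵥ x.ofLp = M *ᵥ x.ofLp ⬝ᵥ M *ᵥ x.ofLp := by
    rw [← mulVec_mulVec, dotProduct_mulVec, vecMul_transpose]
  simp only [star_trivial, sub_mulVec, smul_mulVec, one_mulVec, dotProduct_sub, dotProduct_smul,
    smul_eq_mul, hM] at this
  linarith

/-- The operator norm is monotone for the order interval of a positive semidefinite matrix. -/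
lemma norm_le_of_le_smul {M P : Matrix ι ι ℝ} (hP : 0 ≤ P) {a : ℝ} (ha : 0 ≤ a)
    (h₁ : -(a • P) ≤ M) (h₂ : M ≤ a • P) : ‖M‖ ≤ a * ‖P‖ := by
  -- The slack `ε` covers the case `a * ‖P‖ = 0`, as the previous bound needs a positive radius.
  refine le_of_forall_pos_le_add fun ε hε => ?_
  have key : a • P ≤ (a * ‖P‖ + ε) • (1 : Matrix ι ι ℝ) := by
    refine (smul_mono_right ha (le_norm_smul_one (isSymm_of_nonneg hP))).trans ?_
    rw [smul_smul]
    exact smul_mono_left PosSemidef.one.nonneg (by linarith)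
  exact norm_le_of_le_smul_one (by positivity) ((neg_le_neg key).trans h₁) (h₂.trans key)

lemma neg_norm_smul_one_le {M : Matrix ι ι ℝ} (hM : M.IsSymm) :
    -(‖M‖ • (1 : Matrix ι ι ℝ)) ≤ M := by
  have := le_norm_smul_one (M := -M) (by simpa [IsSymm] using hM)
  rw [norm_neg] at this
  exact neg_le.1 this

omit [Fintype ι] in
lemma posDef_of_smul_one_le {P : Matrix ι ι ℝ} {a : ℝ} (ha : 0 < a) (h : a • 1 ≤ P) :
    P.PosDef := by
  have h1 : (a • (1 : Matrix ι ι ℝ)).PosDef := PosDef.one.smul ha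
  simpa using h1.add_posSemidef (le_iff.1 h)

end LoewnerOrder

end Matrix

/-! ### The smallest eigenvalue -/

section LambdaMin

variable {n : ℕ}

lemma lambdaMin_smul_one_le {S : Matrix (Fin n) (Fin n) ℝ} (hS : S.IsHermitian) :
    lambdaMin S • (1 : Matrix (Fin n) (Fin n) ℝ) ≤ S := by
  rw [← Algebra.algebraMap_eq_smul_one, algebraMap_le_iff_le_spectrum (ha := hS)]
  intro x hx
  exact csInf_le (Matrix.finite_real_spectrum.bddBelow) hx

lemma lambdaMin_pos (hn : 0 < n) {S : Matrix (Fin n) (Fin n) ℝ} (hS : S.PosDef) :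
    0 < lambdaMin S := by
  have : Nonempty (Fin n) := ⟨⟨0, hn⟩⟩
  have hne : (spectrum ℝ S).Nonempty := by
    rw [hS.isHermitian.spectrum_real_eq_range_eigenvalues]
    exact Set.range_nonempty _
  have hmem : lambdaMin S ∈ spectrum ℝ S := hne.csInf_mem Matrix.finite_real_spectrum
  rw [hS.isHermitian.spectrum_real_eq_range_eigenvalues] at hmem
  obtain ⟨i, hi⟩ := hmem
  rw [← hi]
  exact hS.eigenvalues_pos i

end LambdaMin

/-! ### Order properties of the Riccati map -/

section Riccati

variable {n m : ℕ} (A : Matrix (Fin n) (Fin n) ℝ) (B : Matrix (Fin n) (Fin m) ℝ)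
  (R : Matrix (Fin m) (Fin m) ℝ)

/-- The Riccati map with zero state cost, written as a product of square matrices. -/
def riccati (P : Matrix (Fin n) (Fin n) ℝ) : Matrix (Fin n) (Fin n) ℝ :=
  Aᵀ * P * A - Aᵀ * P * (B * (Bᵀ * P * B + R)⁻¹ * Bᵀ) * (P * A)

/-- The greedy feedback gain for the cost matrix `P`. -/
def greedyGain (P : Matrix (Fin n) (Fin n) ℝ) : Matrix (Fin m) (Fin n) ℝ :=
  (Bᵀ * P * B + R)⁻¹ * (Bᵀ * P * A)

/-- The one-step cost-to-go of the feedback gain `K`, with zero state cost. -/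
def gainCost (K : Matrix (Fin m) (Fin n) ℝ) (P : Matrix (Fin n) (Fin n) ℝ) :
    Matrix (Fin n) (Fin n) ℝ :=
  (A - B * K)ᵀ * P * (A - B * K) + Kᵀ * R * K

variable {A B R} {P Q S : Matrix (Fin n) (Fin n) ℝ}

lemma schurComplement_hamiltonian (S) (hP : Pᵀ = P) :
    schurComplement (hamiltonian A B S R P) = riccati A B R P + S := by
  simp only [schurComplement, hamiltonian, riccati, toBlocks_fromBlocks₁₁,
    toBlocks_fromBlocks₂₁, toBlocks_fromBlocks₂₂, transpose_mul, transpose_transpose, hP,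
    Matrix.mul_assoc]
  abel

lemma posDef_inputBlock (hR : R.PosDef) (hP : 0 ≤ P) : (Bᵀ * P * B + R).PosDef :=
  hR.posSemidef_add (nonneg_iff_posSemidef.1 (transpose_mul_mul_nonneg hP B))

/-- Completion of the square in the feedback gain. -/
lemma gainCost_eq (hR : R.PosDef) (hP : 0 ≤ P) (K) :
    gainCost A B R K P = riccati A B R P +
      (K - greedyGain A B R P)ᵀ * (Bᵀ * P * B + R) * (K - greedyGain A B R P) := by
  have hM := posDef_inputBlock (B := B) hR hP
  set M := Bᵀ * P * B + R with hMdef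
  have hMt : Mᵀ = M := isSymm_of_nonneg hM.posSemidef.nonneg
  have hdet : IsUnit M.det := (isUnit_iff_isUnit_det _).1 hM.isUnit
  have hPt := isSymm_of_nonneg hP
  have h1 : M * greedyGain A B R P = Bᵀ * P * A := by
    rw [greedyGain, ← hMdef, mul_nonsing_inv_cancel_left _ _ hdet]
  have h2 : (greedyGain A B R P)ᵀ * M = Aᵀ * P * B := by
    have := congrArg transpose h1
    simpa only [transpose_mul, hMt, hPt, transpose_transpose, Matrix.mul_assoc] using this
  have h3 : riccati A B R P = Aᵀ * P * A - Aᵀ * P * B * greedyGain A B R P := by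
    simp only [riccati, greedyGain, Matrix.mul_assoc]
  have h4 : (K - greedyGain A B R P)ᵀ * M * (K - greedyGain A B R P) =
      Kᵀ * M * K - Kᵀ * (Bᵀ * P * A) - Aᵀ * P * B * K + Aᵀ * P * B * greedyGain A B R P := by
    rw [transpose_sub, Matrix.sub_mul, h2, Matrix.mul_sub, Matrix.sub_mul, Matrix.sub_mul,
      Matrix.mul_assoc Kᵀ M (greedyGain A B R P), h1]
    abel
  rw [h3, h4, hMdef, gainCost]
  simp only [transpose_sub, transpose_mul, Matrix.mul_sub, Matrix.sub_mul, Matrix.mul_add,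
    Matrix.add_mul, Matrix.mul_assoc]
  abel

lemma riccati_le_gainCost (hR : R.PosDef) (hP : 0 ≤ P) (K) :
    riccati A B R P ≤ gainCost A B R K P := by
  rw [gainCost_eq hR hP]
  exact le_add_of_nonneg_right
    (transpose_mul_mul_nonneg (posDef_inputBlock hR hP).posSemidef.nonneg _)

lemma riccati_eq_gainCost (hR : R.PosDef) (hP : 0 ≤ P) :
    riccati A B R P = gainCost A B R (greedyGain A B R P) P := by
  simp [gainCost_eq hR hP]

lemma gainCost_mono (K) (h : P ≤ Q) : gainCost A B R K P ≤ gainCost A B R K Q :=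
  add_le_add_left (transpose_mul_mul_mono h _) _

/-- The greedy gain for `Q` is suboptimal for `P`, and the cost of a fixed gain is monotone. -/
lemma riccati_mono (hR : R.PosDef) (hP : 0 ≤ P) (h : P ≤ Q) :
    riccati A B R P ≤ riccati A B R Q := by
  rw [riccati_eq_gainCost hR (hP.trans h)]
  exact (riccati_le_gainCost hR hP _).trans (gainCost_mono _ h)

lemma transpose_mul_gain_nonneg (hR : R.PosDef) (K : Matrix (Fin m) (Fin n) ℝ) :
    0 ≤ Kᵀ * R * K :=
  transpose_mul_mul_nonneg hR.posSemidef.nonneg K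

lemma riccati_nonneg (hR : R.PosDef) (hP : 0 ≤ P) : 0 ≤ riccati A B R P := by
  rw [riccati_eq_gainCost hR hP]
  exact add_nonneg (transpose_mul_mul_nonneg hP _) (transpose_mul_gain_nonneg hR _)

/-- The Riccati map is subhomogeneous. -/
lemma riccati_smul_le (hR : R.PosDef) (hP : 0 ≤ P) {t : ℝ} (ht : 1 ≤ t) :
    riccati A B R (t • P) ≤ t • riccati A B R P := by
  have ht0 : 0 ≤ t := zero_le_one.trans ht
  refine (riccati_le_gainCost hR (smul_nonneg ht0 hP) (greedyGain A B R P)).trans ?_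
  rw [riccati_eq_gainCost hR hP, gainCost, gainCost, smul_add]
  refine add_le_add ?_ ?_
  · simp
  · simpa using smul_mono_left (transpose_mul_gain_nonneg hR (greedyGain A B R P)) ht

/-- The greedy gain for `t • P` is tested at `P`; shrinking `P` leaves the input cost `Kᵀ * R * K`
unscaled. -/
lemma smul_riccati_le (hR : R.PosDef) (hP : 0 ≤ P) {t : ℝ} (ht0 : 0 ≤ t) (ht : t ≤ 1) :
    t • riccati A B R P ≤ riccati A B R (t • P) := by
  rw [riccati_eq_gainCost hR (smul_nonneg ht0 hP)]
  refine (smul_mono_right ht0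
    (riccati_le_gainCost hR hP (greedyGain A B R (t • P)))).trans ?_
  rw [gainCost, gainCost, smul_add]
  refine add_le_add ?_ ?_
  · simp
  · simpa using smul_mono_left (transpose_mul_gain_nonneg hR (greedyGain A B R (t • P))) ht

/-- Above a fixed point, value iteration contracts the order-unit distance. -/
lemma riccati_add_le_of_le (hR : R.PosDef) (hQ : 0 ≤ Q)
    {c e : ℝ} (hc : c • (riccati A B R Q + S) ≤ S) (he : 0 ≤ e)
    (hP : 0 ≤ P) (h : P ≤ (1 + e) • Q) :
    riccati A B R P + S ≤ (1 + (1 - c) * e) • (riccati A B R Q + S) := by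
  have h1 := (riccati_mono (A := A) (B := B) hR hP h).trans
    (riccati_smul_le hR hQ (by linarith))
  have h2 := smul_mono_right he hc
  calc riccati A B R P + S ≤ (1 + e) • riccati A B R Q + S := add_le_add_left h1 _
    _ = (1 + e) • (riccati A B R Q + S) - e • S := by module
    _ ≤ (1 + e) • (riccati A B R Q + S) - e • (c • (riccati A B R Q + S)) :=
      sub_le_sub_left h2 _
    _ = _ := by module

lemma le_riccati_add_of_le (hR : R.PosDef) (hS : 0 ≤ S) (hQ : 0 ≤ Q)
    {c e : ℝ} (hc1 : c ≤ 1) (hc : c • (riccati A B R Q + S) ≤ S) (he : 0 ≤ e)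
    (hP : 0 ≤ P) (h : (1 - e) • Q ≤ P) :
    (1 - (1 - c) * e) • (riccati A B R Q + S) ≤ riccati A B R P + S := by
  -- For `e > 1` the hypothesis has a negative factor and says nothing; but then `1 - (1 - c) * e ≤
  -- c`, and the state cost alone suffices.
  rcases le_total e 1 with h1 | h1
  · have h2 := (smul_riccati_le (A := A) (B := B) hR hQ (by linarith : 0 ≤ 1 - e)
      (by linarith)).trans (riccati_mono hR (smul_nonneg (by linarith) hQ) h)
    have h3 := smul_mono_right he hc
    calc _ = (1 - e) • (riccati A B R Q + S) + e • (c • (riccati A B R Q + S)) := by module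
      _ ≤ (1 - e) • (riccati A B R Q + S) + e • S := add_le_add_right h3 _
      _ = (1 - e) • riccati A B R Q + S := by module
      _ ≤ _ := add_le_add_left h2 _
  · calc _ ≤ c • (riccati A B R Q + S) :=
          smul_mono_left (add_nonneg (riccati_nonneg hR hQ) hS) (by nlinarith)
      _ ≤ S := hc
      _ ≤ _ := le_add_of_nonneg_left (riccati_nonneg hR hP)

end Riccati

/-! ### Invariance, comparison and stability of inexact value iteration -/

section Dynamics

variable {n m : ℕ} {A : Matrix (Fin n) (Fin n) ℝ} {B : Matrix (Fin n) (Fin m) ℝ}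
  {R : Matrix (Fin m) (Fin m) ℝ} {P P₀ Q S S' : Matrix (Fin n) (Fin n) ℝ}
  {Δ : ℕ → Matrix (Fin n) (Fin n) ℝ}

lemma nonneg_of_smul_one_le {l : ℝ} (hl : 0 ≤ l) (hS : l • 1 ≤ S) : 0 ≤ S := by
  simpa using (smul_mono_left PosSemidef.one.nonneg hl).trans hS

lemma smul_one_le_fixedPoint (hR : R.PosDef) {l : ℝ} (hS : l • 1 ≤ S)
    (hQ : 0 ≤ Q) (hfix : riccati A B R Q + S = Q) : l • 1 ≤ Q := by
  rw [← hfix]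
  exact hS.trans (le_add_of_nonneg_left (riccati_nonneg hR hQ))

/-- The state cost absorbs the disturbance: `S + Δ i ≥ S - ε • 1 ≥ 0`. This keeps the iterates in
the cone where the Riccati map is monotone. -/
lemma inexactVI_nonneg (hR : R.PosDef) {ε : ℝ} (hS : ε • 1 ≤ S) (hΔs : ∀ i, (Δ i).IsSymm)
    (hΔ : ∀ i, ‖Δ i‖ ≤ ε) (hP₀ : 0 ≤ P₀) (i : ℕ) : 0 ≤ inexactVI A B S R Δ P₀ i := by
  induction i with
  | zero => exact hP₀
  | succ i ih =>
    change 0 ≤ schurComplement (hamiltonian A B S R (inexactVI A B S R Δ P₀ i)) + Δ i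
    rw [schurComplement_hamiltonian _ (isSymm_of_nonneg ih), add_assoc]
    refine add_nonneg (riccati_nonneg hR ih) ?_
    rw [← neg_le_iff_add_nonneg', neg_le]
    exact (neg_le.1 (neg_norm_smul_one_le (hΔs i))).trans
      ((smul_mono_left PosSemidef.one.nonneg (hΔ i)).trans hS)

lemma inexactVI_succ (hR : R.PosDef) {ε : ℝ} (hS : ε • 1 ≤ S) (hΔs : ∀ i, (Δ i).IsSymm)
    (hΔ : ∀ i, ‖Δ i‖ ≤ ε) (hP₀ : 0 ≤ P₀) (i : ℕ) :
    inexactVI A B S R Δ P₀ (i + 1) = riccati A B R (inexactVI A B S R Δ P₀ i) + S + Δ i := by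
  rw [← schurComplement_hamiltonian _
    (isSymm_of_nonneg (inexactVI_nonneg hR hS hΔs hΔ hP₀ i))]
  rfl

lemma exactVI_nonneg (hR : R.PosDef) (hS : 0 ≤ S) (hP₀ : 0 ≤ P₀) (i : ℕ) :
    0 ≤ exactVI A B S R P₀ i := by
  induction i with
  | zero => exact hP₀
  | succ i ih =>
    rw [exactVI, schurComplement_hamiltonian _ (isSymm_of_nonneg ih)]
    exact add_nonneg (riccati_nonneg hR ih) hS

lemma exactVI_succ (hR : R.PosDef) (hS : 0 ≤ S) (hP₀ : 0 ≤ P₀) (i : ℕ) :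
    exactVI A B S R P₀ (i + 1) = riccati A B R (exactVI A B S R P₀ i) + S := by
  rw [exactVI, schurComplement_hamiltonian _ (isSymm_of_nonneg (exactVI_nonneg hR hS hP₀ i))]

lemma exactVI_le_inexactVI (hR : R.PosDef) {ε : ℝ} (hS : ε • 1 ≤ S)
    (hΔs : ∀ i, (Δ i).IsSymm) (hΔ : ∀ i, ‖Δ i‖ ≤ ε) (hP₀ : 0 ≤ P₀) (i : ℕ) :
    exactVI A B (S - ε • 1) R P₀ i ≤ inexactVI A B S R Δ P₀ i := by
  induction i with
  | zero => exact le_rfl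
  | succ i ih =>
    rw [exactVI_succ hR (sub_nonneg.2 hS) hP₀, inexactVI_succ hR hS hΔs hΔ hP₀, add_assoc]
    refine add_le_add (riccati_mono hR (exactVI_nonneg hR (sub_nonneg.2 hS) hP₀ i) ih) ?_
    rw [sub_eq_add_neg]
    exact add_le_add_right ((neg_le_neg (smul_mono_left PosSemidef.one.nonneg (hΔ i))).trans
      (neg_norm_smul_one_le (hΔs i))) _

lemma inexactVI_le_exactVI (hR : R.PosDef) {ε : ℝ} (hε : 0 ≤ ε) (hS : ε • 1 ≤ S)
    (hΔs : ∀ i, (Δ i).IsSymm) (hΔ : ∀ i, ‖Δ i‖ ≤ ε) (hP₀ : 0 ≤ P₀) (i : ℕ) :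
    inexactVI A B S R Δ P₀ i ≤ exactVI A B (S + ε • 1) R P₀ i := by
  have hε1 : 0 ≤ ε • (1 : Matrix (Fin n) (Fin n) ℝ) := smul_nonneg hε PosSemidef.one.nonneg
  induction i with
  | zero => exact le_rfl
  | succ i ih =>
    rw [exactVI_succ hR (add_nonneg (hε1.trans hS) hε1) hP₀,
      inexactVI_succ hR hS hΔs hΔ hP₀, add_assoc]
    refine add_le_add (riccati_mono hR (inexactVI_nonneg hR hS hΔs hΔ hP₀ i) ih) ?_
    exact add_le_add_right ((le_norm_smul_one (hΔs i)).trans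
      (smul_mono_left PosSemidef.one.nonneg (hΔ i))) _

/-- Inexact value iteration stays within a geometrically shrinking order interval around the
fixed point. -/
lemma inexactVI_mem_orderInterval (hR : R.PosDef) {l c e ε : ℝ} (hl : 0 < l) (hS : l • 1 ≤ S)
    (hQ : 0 ≤ Q) (hfix : riccati A B R Q + S = Q) (hc0 : 0 < c) (hc1 : c ≤ 1)
    (hc : c • Q ≤ S) (hε0 : 0 ≤ ε) (hε : ε ≤ l) (hΔs : ∀ i, (Δ i).IsSymm)
    (hΔ : ∀ i, ‖Δ i‖ ≤ ε) (hP₀ : 0 ≤ P₀) (he : 0 ≤ e) (h₁ : (1 - e) • Q ≤ P₀)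
    (h₂ : P₀ ≤ (1 + e) • Q) (i : ℕ) :
    (1 - ((1 - c) ^ i * e + ε / (l * c))) • Q ≤ inexactVI A B S R Δ P₀ i ∧
      inexactVI A B S R Δ P₀ i ≤ (1 + ((1 - c) ^ i * e + ε / (l * c))) • Q := by
  have hεS : ε • 1 ≤ S := (smul_mono_left PosSemidef.one.nonneg hε).trans hS
  have hS0 : 0 ≤ S := nonneg_of_smul_one_le hl.le hS
  have hc1' : 0 ≤ 1 - c := by linarith
  have hε1 : ε • (1 : Matrix (Fin n) (Fin n) ℝ) ≤ (ε / l) • Q := by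
    have := smul_mono_right (by positivity : 0 ≤ ε / l) (smul_one_le_fixedPoint hR hS hQ hfix)
    rwa [smul_smul, div_mul_cancel₀ _ hl.ne'] at this
  -- `ε / (l * c)` is the fixed point of `a ↦ (1 - c) * a + ε / l`.
  have hrec : ∀ i, (1 - c) ^ (i + 1) * e + ε / (l * c) =
      (1 - c) * ((1 - c) ^ i * e + ε / (l * c)) + ε / l := fun i => by
    field_simp
    ring
  induction i with
  | zero =>
    have h3 : 0 ≤ ε / (l * c) := by positivity
    simp only [pow_zero, one_mul]
    exact ⟨(smul_mono_left hQ (by linarith)).trans h₁,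
      h₂.trans (smul_mono_left hQ (by linarith))⟩
  | succ i ih =>
    have hx := inexactVI_nonneg (A := A) (B := B) hR hεS hΔs hΔ hP₀ i
    rw [inexactVI_succ hR hεS hΔs hΔ hP₀, hrec]
    have he' : 0 ≤ (1 - c) ^ i * e + ε / (l * c) := by positivity
    have hfc : c • (riccati A B R Q + S) ≤ S := hfix.symm ▸ hc
    have hlo := le_riccati_add_of_le hR hS0 hQ hc1 hfc he' hx ih.1
    have hup := riccati_add_le_of_le hR hQ hfc he' hx ih.2
    rw [hfix] at hlo hup
    set a := (1 - c) ^ i * e + ε / (l * c)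
    have hd : ‖Δ i‖ • (1 : Matrix (Fin n) (Fin n) ℝ) ≤ ε • 1 := smul_mono_left PosSemidef.one.nonneg (hΔ i)
    constructor
    · calc _ = (1 - (1 - c) * a) • Q + -((ε / l) • Q) := by module
        _ ≤ _ := add_le_add hlo (((neg_le_neg hε1).trans (neg_le_neg hd)).trans
          (neg_norm_smul_one_le (hΔs i)))
    · calc _ ≤ (1 + (1 - c) * a) • Q + (ε / l) • Q :=
            add_le_add hup (((le_norm_smul_one (hΔs i)).trans hd).trans hε1)
        _ = _ := by module

/-- Since `Q ≥ l • 1`, the initial order interval can have relative radius `‖P₀ - Q‖ / l`; the final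
interval is converted back to a norm bound. -/
lemma norm_inexactVI_sub_le (hR : R.PosDef) {l c ε : ℝ} (hl : 0 < l) (hS : l • 1 ≤ S)
    (hQ : 0 ≤ Q) (hfix : riccati A B R Q + S = Q) (hc0 : 0 < c) (hc1 : c ≤ 1)
    (hc : c • Q ≤ S) (hε0 : 0 ≤ ε) (hε : ε ≤ l) (hΔs : ∀ i, (Δ i).IsSymm)
    (hΔ : ∀ i, ‖Δ i‖ ≤ ε) (hP₀ : 0 ≤ P₀) (i : ℕ) :
    ‖inexactVI A B S R Δ P₀ i - Q‖ ≤
      ((1 - c) ^ i * (‖P₀ - Q‖ / l) + ε / (l * c)) * ‖Q‖ := by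
  have hsymm : (P₀ - Q).IsSymm := by
    rw [IsSymm, transpose_sub, isSymm_of_nonneg hP₀, isSymm_of_nonneg hQ]
  have hr : ‖P₀ - Q‖ • (1 : Matrix (Fin n) (Fin n) ℝ) ≤ (‖P₀ - Q‖ / l) • Q := by
    have := smul_mono_right (by positivity : 0 ≤ ‖P₀ - Q‖ / l)
      (smul_one_le_fixedPoint hR hS hQ hfix)
    rwa [smul_smul, div_mul_cancel₀ _ hl.ne'] at this
  have hc1' : 0 ≤ 1 - c := by linarith
  obtain ⟨h₁, h₂⟩ := inexactVI_mem_orderInterval hR hl hS hQ hfix hc0 hc1 hc hε0 hε hΔs hΔ hP₀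
    (e := ‖P₀ - Q‖ / l) (by positivity)
    (by
      have := (neg_le_neg hr).trans (neg_norm_smul_one_le hsymm)
      rw [sub_smul, one_smul]
      simpa [sub_eq_add_neg, add_comm] using add_le_add_left this Q)
    (by
      have := (le_norm_smul_one hsymm).trans hr
      rw [add_smul, one_smul]
      exact sub_le_iff_le_add'.1 this) i
  refine norm_le_of_le_smul hQ (by positivity) ?_ ?_
  · rw [le_sub_iff_add_le]
    exact (by module : _ = _).trans_le h₁
  · rw [sub_le_iff_le_add]
    exact h₂.trans_eq (by module)

lemma exists_pos_smul_le {l : ℝ} (hl : 0 < l) (hS : l • 1 ≤ S) (b : ℝ) :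
    ∃ c : ℝ, 0 < c ∧ c < 1 ∧ ∀ Q : Matrix (Fin n) (Fin n) ℝ, 0 ≤ Q → ‖Q‖ ≤ b → c • Q ≤ S := by
  -- This `c` is below `1` and satisfies `c * b ≤ l`, so `c • Q ≤ l • 1 ≤ S`.
  refine ⟨l / (|b| + l + 1), by positivity, ?_, fun Q hQ hb => ?_⟩
  · rw [div_lt_one (by positivity)]
    linarith [abs_nonneg b]
  · refine (smul_mono_right (by positivity) (le_norm_smul_one (isSymm_of_nonneg hQ))).trans
      (le_trans ?_ hS)
    rw [smul_smul]
    refine smul_mono_left PosSemidef.one.nonneg ?_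
    rw [div_mul_eq_mul_div, div_le_iff₀ (by positivity)]
    gcongr
    linarith [le_abs_self b]

/-- Lipschitz dependence of the fixed point on the state cost. -/
lemma norm_fixedPoint_sub_le (hR : R.PosDef) {l c : ℝ} (hl : 0 < l) (hS : l • 1 ≤ S)
    (hQ : 0 ≤ Q) (hfix : riccati A B R Q + S = Q) (hc0 : 0 < c) (hc1 : c < 1)
    (hc : c • Q ≤ S) (hS' : (S' - S).IsSymm) (hSS' : ‖S' - S‖ ≤ l)
    (hP : 0 ≤ P) (hfixP : riccati A B R P + S' = P) :
    ‖P - Q‖ ≤ ‖S' - S‖ / (l * c) * ‖Q‖ := by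
  have hεS : ‖S' - S‖ • 1 ≤ S := (smul_mono_left PosSemidef.one.nonneg hSS').trans hS
  -- `P` is stationary for inexact iteration with cost `S` and constant disturbance `S' - S`, so the
  -- transient term can be sent to zero.
  have hconst : ∀ i, inexactVI A B S R (fun _ => S' - S) P i = P := fun i => by
    induction i with
    | zero => rfl
    | succ i ih =>
      rw [inexactVI_succ hR hεS (fun _ => hS') (fun _ => le_rfl) hP, ih]
      nth_rw 2 [← hfixP]
      abel
  have hbound := fun i => norm_inexactVI_sub_le hR hl hS hQ hfix hc0 hc1.le hc (norm_nonneg _)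
    hSS' (Δ := fun _ => S' - S) (fun _ => hS') (fun _ => le_rfl) hP i
  simp only [hconst] at hbound
  have hpow := tendsto_pow_atTop_nhds_zero_of_lt_one (by linarith : 0 ≤ 1 - c) (by linarith)
  have hlim := ((hpow.mul_const (‖P - Q‖ / l)).add_const (‖S' - S‖ / (l * c))).mul_const ‖Q‖
  rw [zero_mul, zero_add] at hlim
  exact ge_of_tendsto' hlim hbound

lemma fixedPoint_unique (hR : R.PosDef) {l : ℝ} (hl : 0 < l) (hS : l • 1 ≤ S)
    (hQ : 0 ≤ Q) (hfix : riccati A B R Q + S = Q)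
    (hP : 0 ≤ P) (hfixP : riccati A B R P + S = P) : P = Q := by
  obtain ⟨c, hc0, hc1, hc⟩ := exists_pos_smul_le hl hS ‖Q‖
  have := norm_fixedPoint_sub_le hR hl hS hQ hfix hc0 hc1 (hc Q hQ le_rfl) (S' := S)
    (by simp [IsSymm]) (by simpa using hl.le) hP hfixP
  simpa [sub_eq_zero] using this

theorem smallDisturbanceISS_inexactVIStep (hR : R.PosDef) {l : ℝ} (hl : 0 < l)
    (hS : l • 1 ≤ S) (hQ : 0 ≤ Q) (hfix : riccati A B R Q + S = Q) :
    SmallDisturbanceISS (inexactVIStep A B S R) {P | P.PosSemidef} {D | D.IsSymm} Q l := by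
  obtain ⟨c, hc0, hc1, hc⟩ := exists_pos_smul_le hl hS ‖Q‖
  refine ⟨hl, ?_, ?_⟩
  · rw [inexactVIStep, schurComplement_hamiltonian _ (isSymm_of_nonneg hQ), hfix, add_zero]
  lift c to ℝ≥0 using hc0.le
  lift l to ℝ≥0 using hl.le
  norm_cast at hc0 hc1 hl
  have hsub : 0 < 1 - c := tsub_pos_of_lt hc1
  have hk : 0 < ‖Q‖₊ + 1 := by positivity
  -- The summand `1` keeps the factor positive, hence the functions strictly increasing, without
  -- knowing `Q ≠ 0`.
  refine ⟨fun r i => (1 - c) ^ i * (r / l) * (‖Q‖₊ + 1), fun r => r / (l * c) * (‖Q‖₊ + 1),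
    ⟨fun i => ⟨by fun_prop, fun a b hab => ?_, by simp⟩, fun r => ⟨fun i j hij => ?_, ?_⟩⟩,
    ⟨by fun_prop, fun a b hab => ?_, by simp⟩, fun Δ hΔs hΔb hΔl P₀ hP₀ i => ?_⟩
  · have := pow_pos hsub i
    dsimp only
    gcongr
  · dsimp only
    gcongr ?_ * _ * _
    exact pow_le_pow_of_le_one zero_le tsub_le_self hij
  · have hpow := tendsto_pow_atTop_nhds_zero_of_lt_one (r := 1 - c) zero_le
      (tsub_lt_self one_pos hc0)
    simpa using (hpow.mul_const (r / l)).mul_const (‖Q‖₊ + 1)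
  · dsimp only
    gcongr
  · have hΔ : ∀ i, ‖Δ i‖ ≤ (linfNorm Δ : ℝ) := fun i => by
      exact_mod_cast le_ciSup hΔb i
    have := norm_inexactVI_sub_le hR (by exact_mod_cast hl) hS hQ hfix (by exact_mod_cast hc0)
      (by exact_mod_cast hc1.le) (hc Q hQ le_rfl) (NNReal.coe_nonneg _) hΔl.le hΔs hΔ
      (nonneg_iff_posSemidef.2 hP₀) i
    rw [← NNReal.coe_le_coe]
    refine this.trans ?_
    push_cast [NNReal.coe_sub hc1.le]
    rw [← add_mul]
    have h1c : (0 : ℝ) ≤ 1 - c := by exact_mod_cast sub_nonneg.2 (NNReal.coe_le_coe.2 hc1.le)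
    gcongr
    linarith

end Dynamics

/-! ### Smoothness and derivative of the Riccati map -/

section Differentiability

variable {n m : ℕ} (A : Matrix (Fin n) (Fin n) ℝ) (B : Matrix (Fin n) (Fin m) ℝ)
  (R : Matrix (Fin m) (Fin m) ℝ) {P : Matrix (Fin n) (Fin n) ℝ}

/-- The continuous linear map `X ↦ C * X * D`. -/
def sandwich {k l : ℕ} (C : Matrix (Fin k) (Fin l) ℝ) (D : Matrix (Fin l) (Fin k) ℝ) :
    Matrix (Fin l) (Fin l) ℝ →L[ℝ] Matrix (Fin k) (Fin k) ℝ :=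
  LinearMap.toContinuousLinearMap
    { toFun := fun X => C * X * D
      map_add' := fun X Y => by rw [Matrix.mul_add, Matrix.add_mul]
      map_smul' := fun a X => by simp }

lemma sandwich_apply {k l : ℕ} (C : Matrix (Fin k) (Fin l) ℝ) (D : Matrix (Fin l) (Fin k) ℝ)
    (X : Matrix (Fin l) (Fin l) ℝ) : sandwich C D X = C * X * D := rfl

/-- In this form all nonlinear operations take place in algebras of square matrices, where the
product rule and the calculus of `Ring.inverse` apply. -/
lemma riccati_eq_sandwich : riccati A B R = fun P =>
    sandwich Aᵀ A P - Aᵀ * P * sandwich B Bᵀ (Ring.inverse (sandwich Bᵀ B P + R)) * (P * A) := by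
  funext P
  simp only [riccati, sandwich_apply, nonsing_inv_eq_ringInverse]

variable {A B R}

lemma contDiffAt_riccati (h : IsUnit (Bᵀ * P * B + R)) : ContDiffAt ℝ ∞ (riccati A B R) P := by
  rw [riccati_eq_sandwich]
  have hinv : ContDiffAt ℝ ∞ (fun P => Ring.inverse (sandwich Bᵀ B P + R)) P := by
    refine ContDiffAt.comp P (g := Ring.inverse) (f := fun P => sandwich Bᵀ B P + R) ?_
      ((sandwich Bᵀ B).contDiff.contDiffAt.add contDiffAt_const)
    obtain ⟨u, hu⟩ := h
    rw [sandwich_apply, ← hu]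
    exact contDiffAt_ringInverse ℝ u
  exact (sandwich Aᵀ A).contDiff.contDiffAt.sub
    (((contDiffAt_const.mul contDiffAt_id).mul ((sandwich B Bᵀ).contDiff.contDiffAt.comp P hinv)).mul
      (contDiffAt_id.mul contDiffAt_const))

/-- The derivative of the Riccati map is conjugation by the closed-loop matrix. -/
lemma hasFDerivAt_riccati (hR : R.PosDef) (hP : 0 ≤ P) :
    HasFDerivAt (riccati A B R)
      (sandwich (A - B * greedyGain A B R P)ᵀ (A - B * greedyGain A B R P)) P := by
  have hM := posDef_inputBlock (B := B) hR hP
  obtain ⟨u, hu⟩ := hM.isUnit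
  have hinv : HasFDerivAt (fun P => Ring.inverse (sandwich Bᵀ B P + R))
      ((-((ContinuousLinearMap.mulLeftRight ℝ (Matrix (Fin m) (Fin m) ℝ)) ↑u⁻¹) ↑u⁻¹).comp
        (sandwich Bᵀ B)) P := by
    refine HasFDerivAt.comp P (g := Ring.inverse) (f := fun P => sandwich Bᵀ B P + R) ?_
      ((sandwich Bᵀ B).hasFDerivAt.add_const R)
    rw [sandwich_apply, ← hu]
    exact hasFDerivAt_ringInverse u
  have hid := hasFDerivAt_id (𝕜 := ℝ) P
  have h := (sandwich Aᵀ A).hasFDerivAt.sub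
    ((((hasFDerivAt_const Aᵀ P).mul' hid).mul' ((sandwich B Bᵀ).hasFDerivAt.comp P hinv)).mul'
      (hid.mul' (hasFDerivAt_const A P)))
  rw [riccati_eq_sandwich]
  refine h.congr_fderiv ?_
  ext1 H
  have hui : (↑u⁻¹ : Matrix (Fin m) (Fin m) ℝ) = (Bᵀ * P * B + R)⁻¹ := by
    rw [← hu, coe_units_inv]
  have hri : Ring.inverse (Bᵀ * P * B + R) = (Bᵀ * P * B + R)⁻¹ :=
    (nonsing_inv_eq_ringInverse _).symm
  have hMt : ((Bᵀ * P * B + R)⁻¹)ᵀ = (Bᵀ * P * B + R)⁻¹ :=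
    isSymm_of_nonneg hM.inv.posSemidef.nonneg
  simp [sandwich_apply, hui, hri, greedyGain, isSymm_of_nonneg hP, hMt]
  simp only [Matrix.mul_sub, Matrix.sub_mul, Matrix.mul_assoc]
  abel

end Differentiability

/-! ### Closed-loop stability and smooth dependence on the cost -/

section FixedPoint

variable {n m : ℕ} {A : Matrix (Fin n) (Fin n) ℝ} {B : Matrix (Fin n) (Fin m) ℝ}
  {R : Matrix (Fin m) (Fin m) ℝ} {P Q S : Matrix (Fin n) (Fin n) ℝ}

lemma norm_transpose (F : Matrix (Fin n) (Fin n) ℝ) : ‖Fᵀ‖ = ‖F‖ := by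
  rw [← conjTranspose_eq_transpose_of_trivial, l2_opNorm_conjTranspose]

lemma norm_transpose_mul_mul_le (F W : Matrix (Fin n) (Fin n) ℝ) :
    ‖Fᵀ * W * F‖ ≤ ‖F‖ ^ 2 * ‖W‖ :=
  calc ‖Fᵀ * W * F‖ ≤ ‖Fᵀ‖ * ‖W‖ * ‖F‖ :=
        (norm_mul_le _ _).trans (mul_le_mul_of_nonneg_right (norm_mul_le _ _) (norm_nonneg _))
    _ = _ := by rw [norm_transpose]; ring

/-- A strict Lyapunov inequality makes the powers decay. -/
lemma tendsto_norm_pow_sq {F : Matrix (Fin n) (Fin n) ℝ} {l c : ℝ} (hl : 0 < l)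
    (hP : l • 1 ≤ P) (hc0 : 0 < c) (hc1 : c < 1) (h : Fᵀ * P * F ≤ (1 - c) • P) :
    Filter.Tendsto (fun k => ‖F ^ k‖ ^ 2) Filter.atTop (nhds 0) := by
  have hP0 := nonneg_of_smul_one_le hl.le hP
  have hpow : ∀ k, (F ^ k)ᵀ * P * F ^ k ≤ (1 - c) ^ k • P := fun k => by
    induction k with
    | zero => simp
    | succ k ih =>
      calc (F ^ (k + 1))ᵀ * P * F ^ (k + 1) = Fᵀ * ((F ^ k)ᵀ * P * F ^ k) * F := by
            rw [pow_succ, transpose_mul]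
            simp only [Matrix.mul_assoc]
        _ ≤ Fᵀ * ((1 - c) ^ k • P) * F := transpose_mul_mul_mono ih F
        _ = (1 - c) ^ k • (Fᵀ * P * F) := by simp
        _ ≤ (1 - c) ^ k • ((1 - c) • P) := smul_mono_right (pow_nonneg (by linarith) k) h
        _ = _ := by rw [smul_smul, pow_succ]
  have hbound : ∀ k, ‖F ^ k‖ ^ 2 ≤ (1 - c) ^ k * (l⁻¹ * ‖P‖) := fun k => by
    have h1 : (F ^ k)ᵀ * F ^ k ≤ ((1 - c) ^ k * l⁻¹) • P := by
      have := smul_mono_right (inv_nonneg.2 hl.le)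
        ((transpose_mul_mul_mono hP (F ^ k)).trans (hpow k))
      simpa [smul_smul, hl.ne', mul_comm] using this
    have h0 : 0 ≤ (F ^ k)ᵀ * F ^ k := by
      simpa using transpose_mul_mul_nonneg PosSemidef.one.nonneg (F ^ k)
    have hpk : 0 ≤ (1 - c) ^ k * l⁻¹ := mul_nonneg (pow_nonneg (by linarith) k) (by positivity)
    have := norm_le_of_le_smul hP0 hpk
      ((neg_nonpos.2 (smul_nonneg hpk hP0)).trans h0) h1
    rw [← conjTranspose_eq_transpose_of_trivial, l2_opNorm_conjTranspose_mul_self] at this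
    linarith
  have hlim := (tendsto_pow_atTop_nhds_zero_of_lt_one (by linarith : 0 ≤ 1 - c)
    (by linarith)).mul_const (l⁻¹ * ‖P‖)
  rw [zero_mul] at hlim
  exact squeeze_zero (fun k => by positivity) hbound hlim

/-- The linearized value iteration at a fixed point has no fixed direction. -/
lemma injective_id_sub_sandwich {F : Matrix (Fin n) (Fin n) ℝ}
    (hF : Filter.Tendsto (fun k => ‖F ^ k‖ ^ 2) Filter.atTop (nhds 0)) :
    Function.Injective (ContinuousLinearMap.id ℝ (Matrix (Fin n) (Fin n) ℝ) - sandwich Fᵀ F) := by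
  rw [injective_iff_map_eq_zero]
  intro H hH
  have h1 : Fᵀ * H * F = H := by
    simpa [sandwich_apply, sub_eq_zero, eq_comm] using hH
  have hpow : ∀ k, (F ^ k)ᵀ * H * F ^ k = H := fun k => by
    induction k with
    | zero => simp
    | succ k ih =>
      calc (F ^ (k + 1))ᵀ * H * F ^ (k + 1) = Fᵀ * ((F ^ k)ᵀ * H * F ^ k) * F := by
            rw [pow_succ, transpose_mul]
            simp only [Matrix.mul_assoc]
        _ = H := by rw [ih, h1]
  have hlim := hF.mul_const ‖H‖
  rw [zero_mul] at hlim
  refine norm_le_zero_iff.1 (ge_of_tendsto' hlim fun k => ?_)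
  calc ‖H‖ = ‖(F ^ k)ᵀ * H * F ^ k‖ := by rw [hpow]
    _ ≤ _ := norm_transpose_mul_mul_le _ _

/-- The fixed-point equation in closed-loop form is a Lyapunov equation for `Q`, with decrease at
least `S ≥ c • Q`. -/
lemma tendsto_closedLoop_pow (hR : R.PosDef) {l : ℝ} (hl : 0 < l) (hS : l • 1 ≤ S)
    (hQ : 0 ≤ Q) (hfix : riccati A B R Q + S = Q) :
    Filter.Tendsto (fun k => ‖(A - B * greedyGain A B R Q) ^ k‖ ^ 2) Filter.atTop (nhds 0) := by
  obtain ⟨c, hc0, hc1, hc⟩ := exists_pos_smul_le hl hS ‖Q‖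
  refine tendsto_norm_pow_sq hl (smul_one_le_fixedPoint hR hS hQ hfix) hc0 hc1 ?_
  rw [riccati_eq_gainCost hR hQ, gainCost] at hfix
  set F := A - B * greedyGain A B R Q
  calc Fᵀ * Q * F ≤ Fᵀ * Q * F + (greedyGain A B R Q)ᵀ * R * greedyGain A B R Q :=
        le_add_of_nonneg_right (transpose_mul_gain_nonneg hR _)
    _ = Q - S := eq_sub_of_add_eq hfix
    _ ≤ Q - c • Q := sub_le_sub_left (hc Q hQ le_rfl) _
    _ = _ := by rw [sub_smul, one_smul]

open Filter in
/-- A continuous family of fixed points is smooth in an additive shift of the state cost. -/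
theorem contDiffAt_fixedPoint (hR : R.PosDef) {l δ₀ : ℝ} (hl : 0 < l) (hS : l • 1 ≤ S + δ₀ • 1)
    {p : ℝ → Matrix (Fin n) (Fin n) ℝ} (hp0 : 0 ≤ p δ₀) (hcont : ContinuousAt p δ₀)
    (hp : ∀ᶠ δ in nhds δ₀, riccati A B R (p δ) + (S + δ • 1) = p δ) :
    ContDiffAt ℝ ∞ p δ₀ := by
  set F := A - B * greedyGain A B R (p δ₀)
  have hinj := injective_id_sub_sandwich
    (tendsto_closedLoop_pow hR hl hS hp0 hp.self_of_nhds)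
  let e : Matrix (Fin n) (Fin n) ℝ ≃L[ℝ] Matrix (Fin n) (Fin n) ℝ :=
    (LinearEquiv.ofInjectiveEndo _ hinj).toContinuousLinearEquiv
  let G : Matrix (Fin n) (Fin n) ℝ → Matrix (Fin n) (Fin n) ℝ := fun X => X - riccati A B R X
  have hG : ContDiffAt ℝ ∞ G (p δ₀) :=
    contDiffAt_id.sub (contDiffAt_riccati (posDef_inputBlock hR hp0).isUnit)
  have hG' : HasFDerivAt G (e : Matrix (Fin n) (Fin n) ℝ →L[ℝ] Matrix (Fin n) (Fin n) ℝ)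
      (p δ₀) :=
    ((hasFDerivAt_id (𝕜 := ℝ) (p δ₀)).sub (hasFDerivAt_riccati hR hp0)).congr_fderiv (by
      ext1 H
      rfl)
  have hGp : ∀ᶠ δ in nhds δ₀, G (p δ) = S + δ • 1 :=
    hp.mono fun δ h => sub_eq_of_eq_add' h.symm
  have hn : (∞ : WithTop ℕ∞) ≠ 0 := by simp
  have hinv := hG.to_localInverse hG' hn
  rw [hGp.self_of_nhds] at hinv
  have hshift : ContDiffAt ℝ ∞ (fun δ : ℝ => S + δ • (1 : Matrix (Fin n) (Fin n) ℝ)) δ₀ :=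
    contDiffAt_const.add (contDiffAt_id.smul contDiffAt_const)
  refine (ContDiffAt.comp δ₀ hinv hshift).congr_of_eventuallyEq ?_
  -- Continuity keeps `p δ` in the neighbourhood where the local inverse of `G` undoes `G`, so `p`
  -- agrees there with the smooth branch.
  have hleft := (hG.hasStrictFDerivAt' hG' hn).eventually_left_inverse
  filter_upwards [hcont.eventually hleft, hGp] with δ h1 h2
  rw [Function.comp_apply, ← h2]
  exact h1.symm

end FixedPoint

/-! ### Existence of a fixed point under stabilizability -/

section Existence

open Filter

variable {n m : ℕ} {A : Matrix (Fin n) (Fin n) ℝ} {B : Matrix (Fin n) (Fin m) ℝ}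
  {R : Matrix (Fin m) (Fin m) ℝ} {P S : Matrix (Fin n) (Fin n) ℝ}

lemma norm_le_norm_map_ofReal (M : Matrix (Fin n) (Fin n) ℝ) :
    ‖M‖ ≤ ‖M.map (algebraMap ℝ ℂ)‖ := by
  rw [← l2_opNorm_toEuclideanCLM]
  refine ContinuousLinearMap.opNorm_le_bound _ (norm_nonneg _) fun x => ?_
  have h := l2_opNorm_mulVec (M.map (algebraMap ℝ ℂ)) (WithLp.toLp 2 fun i => (x i : ℂ))
  have h1 : (M.map (algebraMap ℝ ℂ)) *ᵥ (fun i => (x i : ℂ)) =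
      fun i => (((M *ᵥ x.ofLp) i : ℝ) : ℂ) := by
    funext i
    simp [mulVec, dotProduct]
  have h2 : ∀ v : Fin n → ℝ, ‖WithLp.toLp 2 fun i => (v i : ℂ)‖ = ‖WithLp.toLp 2 v‖ := fun v => by
    simp [EuclideanSpace.norm_eq]
  rw [h1, h2 x.ofLp] at h
  exact (h2 (M *ᵥ x.ofLp)).symm.trans_le h

/-- Gelfand's formula for the complexified matrix bounds `‖F ^ k‖` by `r ^ k` eventually, for some
`r < 1`. -/
lemma IsSchurStable.summable_norm_pow_sq {F : Matrix (Fin n) (Fin n) ℝ} (hF : IsSchurStable F) :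
    Summable fun k => ‖F ^ k‖ ^ 2 := by
  obtain ⟨r, hr, hr1⟩ := ENNReal.lt_iff_exists_nnreal_btwn.1 hF
  have hr1' : r < 1 := by exact_mod_cast hr1
  have hev := (spectrum.pow_nnnorm_pow_one_div_tendsto_nhds_spectralRadius
    (F.map (algebraMap ℝ ℂ))).eventually_lt_const hr
  have hle : ∀ᶠ k : ℕ in atTop, ‖‖F ^ k‖ ^ 2‖ ≤ ((r : ℝ) ^ 2) ^ k := by
    filter_upwards [hev, eventually_gt_atTop 0] with k hk hk0
    have hk0' : (0 : ℝ) < k := by exact_mod_cast hk0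
    rw [one_div] at hk
    have h1 := (ENNReal.rpow_inv_le_iff hk0').1 hk.le
    rw [ENNReal.rpow_natCast] at h1
    have h2 : ‖(F.map (algebraMap ℝ ℂ)) ^ k‖ ≤ (r : ℝ) ^ k := by exact_mod_cast h1
    have h3 : (F.map (algebraMap ℝ ℂ)) ^ k = (F ^ k).map (algebraMap ℝ ℂ) :=
      (map_pow (algebraMap ℝ ℂ).mapMatrix F k).symm
    rw [h3] at h2
    have h4 := (norm_le_norm_map_ofReal (F ^ k)).trans h2
    rw [Real.norm_of_nonneg (by positivity), ← pow_mul, mul_comm 2 k, pow_mul]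
    gcongr
  refine Summable.of_norm_bounded_eventually_nat (summable_geometric_of_lt_one (by positivity) ?_)
    hle
  exact pow_lt_one₀ r.2 (by exact_mod_cast hr1') two_ne_zero

/-- Stabilizability bounds value iteration started at zero. -/
lemma exists_norm_exactVI_le (hAB : IsStabilizable A B) (hR : R.PosDef) (hS : 0 ≤ S) :
    ∃ b, ∀ i, ‖exactVI A B S R 0 i‖ ≤ b := by
  obtain ⟨K, hK⟩ := hAB
  set F := A - B * K with hF
  set W := Kᵀ * R * K + S with hW
  -- The optimal finite-horizon cost is at most the accumulated cost of the fixed gain `K`.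
  have hle : ∀ i, exactVI A B S R 0 i ≤ ∑ k ∈ Finset.range i, (F ^ k)ᵀ * W * F ^ k := fun i => by
    induction i with
    | zero => simp [exactVI]
    | succ i ih =>
      have hP := exactVI_nonneg (A := A) (B := B) hR hS le_rfl i
      have h1 : ∀ k, (F ^ (k + 1))ᵀ * W * F ^ (k + 1) = Fᵀ * ((F ^ k)ᵀ * W * F ^ k) * F :=
        fun k => by
          rw [pow_succ, transpose_mul]
          simp only [Matrix.mul_assoc]
      rw [exactVI_succ hR hS le_rfl, Finset.sum_range_succ']
      simp only [h1, ← Finset.mul_sum, ← Finset.sum_mul, pow_zero, transpose_one, one_mul, mul_one]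
      refine (add_le_add_left (riccati_le_gainCost hR hP K) S).trans ?_
      rw [gainCost, add_assoc]
      exact add_le_add_left (transpose_mul_mul_mono ih F) _
  refine ⟨(∑' k, ‖F ^ k‖ ^ 2) * ‖W‖, fun i => ?_⟩
  have hP := exactVI_nonneg (A := A) (B := B) hR hS le_rfl i
  have hX := hP.trans (hle i)
  have h1 := norm_le_of_le_smul hX zero_le_one
    ((neg_nonpos.2 (smul_nonneg zero_le_one hX)).trans hP) ((hle i).trans_eq (one_smul _ _).symm)
  rw [one_mul] at h1
  refine h1.trans ((norm_sum_le _ _).trans ?_)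
  refine (Finset.sum_le_sum fun k _ => norm_transpose_mul_mul_le (F ^ k) W).trans ?_
  rw [← Finset.sum_mul]
  gcongr
  exact hK.summable_norm_pow_sq.sum_le_tsum _ fun k _ => by positivity

lemma nonneg_of_tendsto {p : ℕ → Matrix (Fin n) (Fin n) ℝ} (hp : ∀ i, 0 ≤ p i)
    (h : Tendsto p atTop (nhds P)) : 0 ≤ P := by
  rw [nonneg_iff_posSemidef]
  refine .of_dotProduct_mulVec_nonneg ?_ fun x => ?_
  · have h1 : Tendsto (fun i => (p i)ᴴ) atTop (nhds Pᴴ) :=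
      (continuous_id.matrix_conjTranspose.tendsto P).comp h
    refine tendsto_nhds_unique h1 (h.congr fun i => ?_)
    exact (nonneg_iff_posSemidef.1 (hp i)).isHermitian.eq.symm
  · have hc : Continuous fun M : Matrix (Fin n) (Fin n) ℝ => star x ⬝ᵥ M *ᵥ x := by fun_prop
    exact ge_of_tendsto' ((hc.tendsto P).comp h) fun i =>
      (nonneg_iff_posSemidef.1 (hp i)).dotProduct_mulVec_nonneg x

/-- Existence of a positive semidefinite solution of the Riccati equation. -/
theorem exists_fixedPoint (hAB : IsStabilizable A B) (hR : R.PosDef) {l : ℝ} (hl : 0 < l)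
    (hS : l • 1 ≤ S) : ∃ P, 0 ≤ P ∧ riccati A B R P + S = P := by
  have hS0 := nonneg_of_smul_one_le hl.le hS
  obtain ⟨b, hb⟩ := exists_norm_exactVI_le hAB hR hS0
  obtain ⟨c, hc0, hc1, hc⟩ := exists_pos_smul_le hl hS b
  -- The index is shifted so that the sequence starts at `S`: the zero matrix dominates no nonzero
  -- positive iterate, whereas `p 1 ≤ c⁻¹ • S`.
  set p : ℕ → Matrix (Fin n) (Fin n) ℝ := fun i => exactVI A B S R 0 (i + 1) with hp
  have hp0 : ∀ i, 0 ≤ p i := fun i => exactVI_nonneg hR hS0 le_rfl _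
  have hps : ∀ i, p (i + 1) = riccati A B R (p i) + S := fun i => exactVI_succ hR hS0 le_rfl _
  have hpb : ∀ i, ‖p i‖ ≤ b := fun i => hb _
  have hpc : ∀ i, c • p i ≤ S := fun i => hc _ (hp0 i) (hpb i)
  have hpS : p 0 = S := by
    change exactVI A B S R 0 1 = S
    rw [exactVI_succ hR hS0 le_rfl]
    simp [exactVI, riccati]
  have hmono : ∀ i, p i ≤ p (i + 1) := fun i => by
    induction i with
    | zero =>
      rw [hps, hpS]
      exact le_add_of_nonneg_left (riccati_nonneg hR hS0)
    | succ i ih =>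
      rw [hps i, hps (i + 1)]
      exact add_le_add_left (riccati_mono hR (hp0 i) ih) S
  have hinc : ∀ i, p (i + 1) ≤ (1 + (1 - c) ^ i * c⁻¹) • p i := fun i => by
    induction i with
    | zero =>
      have := smul_mono_right (inv_nonneg.2 hc0.le) (hpc 1)
      rw [smul_smul, inv_mul_cancel₀ hc0.ne', one_smul] at this
      rw [hpS, pow_zero, one_mul, add_smul, one_smul]
      exact this.trans (le_add_of_nonneg_left hS0)
    | succ i ih =>
      -- The one-step estimate does not need its reference matrix to be a fixed point, so it applies
      -- with the moving reference `p i`.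
      have hfc : c • (riccati A B R (p i) + S) ≤ S := hps i ▸ hpc (i + 1)
      have := riccati_add_le_of_le hR (hp0 i) hfc
        (mul_nonneg (pow_nonneg (by linarith) i) (by positivity)) (hp0 (i + 1)) ih
      rw [← hps, ← hps] at this
      exact this.trans_eq (by rw [pow_succ]; congr 1; ring)
  have hcauchy : CauchySeq p := by
    refine cauchySeq_of_le_geometric (1 - c) (c⁻¹ * b) (by linarith) fun i => ?_
    have hk : 0 ≤ (1 - c) ^ i * c⁻¹ := mul_nonneg (pow_nonneg (by linarith) i) (by positivity)
    have h1 : p (i + 1) - p i ≤ ((1 - c) ^ i * c⁻¹) • p i := by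
      have := hinc i
      rw [add_smul, one_smul] at this
      exact sub_le_iff_le_add'.2 this
    have := norm_le_of_le_smul (hp0 i) hk
      ((neg_nonpos.2 (smul_nonneg hk (hp0 i))).trans (sub_nonneg.2 (hmono i))) h1
    rw [dist_comm, dist_eq_norm]
    refine this.trans ?_
    rw [mul_comm (c⁻¹ * b), ← mul_assoc]
    exact mul_le_mul_of_nonneg_left (hpb i) hk
  obtain ⟨P, hP⟩ := cauchySeq_tendsto_of_complete hcauchy
  have hP0 := nonneg_of_tendsto hp0 hP
  refine ⟨P, hP0, ?_⟩
  have hcont : ContinuousAt (riccati A B R) P := (hasFDerivAt_riccati hR hP0).continuousAt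
  refine tendsto_nhds_unique ?_ (hP.comp (tendsto_add_atTop_nat 1))
  exact ((hcont.tendsto.comp hP).add_const S).congr fun i => (hps i).symm

end Existence

/-! ### Continuity in the cost shift and the main theorem -/

section ValueIteration

open Filter

variable {n m : ℕ} {A : Matrix (Fin n) (Fin n) ℝ} {B : Matrix (Fin n) (Fin m) ℝ}
  {R : Matrix (Fin m) (Fin m) ℝ} {S : Matrix (Fin n) (Fin n) ℝ}

lemma solvesDARE_iff {P : Matrix (Fin n) (Fin n) ℝ} (hP : 0 ≤ P) :
    SolvesDARE A B S R P ↔ riccati A B R P + S = P := by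
  rw [SolvesDARE, schurComplement_hamiltonian _ (isSymm_of_nonneg hP), eq_comm]

/-- A family of fixed points is continuous in an additive shift of the state cost. -/
lemma continuousAt_fixedPoint (hR : R.PosDef) {l δ₀ : ℝ} (hl : 0 < l)
    (hS : l • 1 ≤ S + δ₀ • 1) {p : ℝ → Matrix (Fin n) (Fin n) ℝ}
    (hp : ∀ᶠ δ in nhds δ₀, 0 ≤ p δ ∧ riccati A B R (p δ) + (S + δ • 1) = p δ) :
    ContinuousAt p δ₀ := by
  obtain ⟨hp0, hfix⟩ := hp.self_of_nhds
  obtain ⟨c, hc0, hc1, hc⟩ := exists_pos_smul_le hl hS ‖p δ₀‖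
  let d : ℝ → ℝ := fun δ => ‖S + δ • (1 : Matrix (Fin n) (Fin n) ℝ) - (S + δ₀ • 1)‖
  have hd : Tendsto d (nhds δ₀) (nhds 0) := by
    have : Continuous d := by fun_prop
    simpa [d] using this.tendsto δ₀
  have hlim := (hd.div_const (l * c)).mul_const ‖p δ₀‖
  rw [zero_div, zero_mul] at hlim
  rw [ContinuousAt, tendsto_iff_norm_sub_tendsto_zero]
  refine squeeze_zero' (Eventually.of_forall fun _ => norm_nonneg _) ?_ hlim
  filter_upwards [hp, hd.eventually_le_const hl] with δ h1 h2
  refine norm_fixedPoint_sub_le hR hl hS hp0 hfix hc0 hc1 (hc _ hp0 le_rfl) ?_ h2 h1.1 h1.2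
  rw [add_sub_add_left_eq_sub, ← sub_smul]
  exact isSymm_one.smul _

end ValueIteration

theorem theorem4p2 {n m : ℕ} (hn : 0 < n)
    (A : Matrix (Fin n) (Fin n) ℝ) (B : Matrix (Fin n) (Fin m) ℝ)
    (S : Matrix (Fin n) (Fin n) ℝ) (R : Matrix (Fin m) (Fin m) ℝ)
    (hAB : IsStabilizable A B) (hS : S.PosDef) (hR : R.PosDef) :
    ∃ Pstar : ℝ → Matrix (Fin n) (Fin n) ℝ,
      -- for each admissible shift, `Pstar δ` is the unique solution of the DARE with cost `S + δ I`
      (∀ δ : ℝ, -lambdaMin S < δ →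
        (Pstar δ).PosDef ∧ SolvesDARE A B (S + δ • 1) R (Pstar δ) ∧
          ∀ P : Matrix (Fin n) (Fin n) ℝ, P.PosSemidef →
            SolvesDARE A B (S + δ • 1) R P → P = Pstar δ) ∧
      -- it depends smoothly on the shift
      ContDiffOn ℝ ∞ Pstar (Set.Ioi (-lambdaMin S)) ∧
      -- inexact VI is small-disturbance ISS at `P* = Pstar 0`, with threshold `λ_min(S)`
      SmallDisturbanceISS (inexactVIStep A B S R) {P | P.PosSemidef} {D | D.IsSymm}
        (Pstar 0) (lambdaMin S) ∧
      -- the iterates stay positive semidefinite and between the two shifted exact VI runs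
      ∀ Δ : ℕ → Matrix (Fin n) (Fin n) ℝ, (∀ i, (Δ i).IsSymm) → IsBoundedSeq Δ →
        (linfNorm Δ : ℝ) < lambdaMin S →
        ∀ P₀ : Matrix (Fin n) (Fin n) ℝ, P₀.PosSemidef → ∀ i : ℕ,
          (inexactVI A B S R Δ P₀ i).PosSemidef ∧
          (inexactVI A B S R Δ P₀ i
            - exactVI A B (S - (linfNorm Δ : ℝ) • 1) R P₀ i).PosSemidef ∧
          (exactVI A B (S + (linfNorm Δ : ℝ) • 1) R P₀ i
            - inexactVI A B S R Δ P₀ i).PosSemidef := by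
  have hl := lambdaMin_pos hn hS
  have hlS := lambdaMin_smul_one_le hS.isHermitian
  have hshift : ∀ δ : ℝ, (lambdaMin S + δ) • (1 : Matrix (Fin n) (Fin n) ℝ) ≤ S + δ • 1 :=
    fun δ => by
      rw [add_smul]
      exact add_le_add_left hlS _
  -- Guarding the claim by the admissibility of `δ` lets `p` be chosen on all of `ℝ`, with an
  -- arbitrary value outside the range.
  have hex : ∀ δ : ℝ, ∃ P : Matrix (Fin n) (Fin n) ℝ, -lambdaMin S < δ →
      0 ≤ P ∧ riccati A B R P + (S + δ • 1) = P := fun δ => by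
    by_cases h : -lambdaMin S < δ
    · obtain ⟨P, hP⟩ := exists_fixedPoint hAB hR (by linarith) (hshift δ)
      exact ⟨P, fun _ => hP⟩
    · exact ⟨0, fun h' => absurd h' h⟩
  choose p hp using hex
  refine ⟨p, fun δ hδ => ?_, fun δ hδ => ?_, ?_, fun Δ hΔs hΔb hΔl P₀ hP₀ i => ?_⟩
  · obtain ⟨h0, hfix⟩ := hp δ hδ
    have hpos : 0 < lambdaMin S + δ := by linarith
    refine ⟨posDef_of_smul_one_le hpos (smul_one_le_fixedPoint hR (hshift δ) h0 hfix),
      (solvesDARE_iff h0).2 hfix, fun P hP hPs => ?_⟩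
    exact fixedPoint_unique hR hpos (hshift δ) h0 hfix hP.nonneg ((solvesDARE_iff hP.nonneg).1 hPs)
  · rw [Set.mem_Ioi] at hδ
    have hpos : 0 < lambdaMin S + δ := by linarith
    have hev : ∀ᶠ δ' in nhds δ, 0 ≤ p δ' ∧ riccati A B R (p δ') + (S + δ' • 1) = p δ' :=
      (eventually_gt_nhds hδ).mono hp
    exact (contDiffAt_fixedPoint hR hpos (hshift δ) (hp δ hδ).1
      (continuousAt_fixedPoint hR hpos (hshift δ) hev) (hev.mono fun _ h => h.2)).contDiffWithinAt
  · obtain ⟨h0, hfix⟩ := hp 0 (by linarith)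
    exact smallDisturbanceISS_inexactVIStep hR hl hlS h0 (by simpa using hfix)
  · have hΔ : ∀ i, ‖Δ i‖ ≤ (linfNorm Δ : ℝ) := fun i => by
      exact_mod_cast le_ciSup hΔb i
    have hS' := (smul_mono_left PosSemidef.one.nonneg hΔl.le).trans hlS
    exact ⟨(inexactVI_nonneg hR hS' hΔs hΔ hP₀.nonneg i).posSemidef,
      exactVI_le_inexactVI hR hS' hΔs hΔ hP₀.nonneg i,
      inexactVI_le_exactVI hR (NNReal.coe_nonneg _) hS' hΔs hΔ hP₀.nonneg i⟩

end
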